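/- A \emph{noncommutative space} $X$ is a locally noetherian Grothendieck category $\operatorname{Mod}X$ (one with a set of noetherian generators); its objects are called $X$-modules. A \emph{weakly closed subspace} $Z$ of $X$ is a full subcategory $\operatorname{Mod}Z$ closed under isomorphisms, subobjects and quotients whose inclusion functor $i_*$ has a right adjoint $i^!$; it is \emph{closed} if $i_*$ also has a left adjoint. For an $X$-module $M$ let $\pi[M]$ be the smallest closed subspace containing $M$. The module $M$ is \emph{prime} if $\pi[N]=\pi[M]$ for every nonzero submodule $N\le M$; $X$ has \emph{enough prime modules} if every nonzero $X$-module has a nonzero prime submodule; $X_{\rm red}$ is the smallest closed subspace of $X$ containing all prime $X$-modules. $\operatorname{Inj}(X)$ is the set of isomorphism classes of indecomposable injective $X$-modules, with the topology generated by declaring closed the sets $V(Z)=\{[E] : i^!E\neq 0\}$ for $Z$ weakly closed in $X$. $X$ is \emph{topologically irreducible} if $\operatorname{Inj}(X)$ is an irreducible (in particular nonempty) topological space. (a) Let $X$ be a noncommutative space with enough prime modules and let $i:X_{\rm red}\to X$ be the inclusion. Then the induced map $\operatorname{Inj}(X_{\rm red})\to\operatorname{Inj}(X)$, $[E]\mapsto[E(i_*E)]$,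 where $E(-)$ denotes the injective hull, is (well defined and) a homeomorphism. (b) Let $R$ be a right noetherian ring, let $\operatorname{Mod}R$ be the category of right $R$-modules and let $\operatorname{Nil}(R)$ be the intersection of the prime ideals of $R$. Then $\operatorname{Mod}R$ is topologically irreducible if and only if $R/\operatorname{Nil}(R)$ is a (nonzero) prime ring. -/

import Mathlib

open CategoryTheory CategoryTheory.Limits

universe u v w

namespace NCSpace

/-! ### Weakly closed and closed subspaces

A noncommutative space `X` is a Grothendieck category `C = Mod X`. A (full) subcategory of `C` is
given by a predicate on its objects. -/

section Subspaces

variable {C : Type u} [Category.{v} C]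

/-- A weakly closed subspace `Z` of a space: a full subcategory which is closed under subobjects and
quotients (hence under subquotients, kernels and isomorphisms) and whose inclusion functor `i_*` has
a right adjoint `i^!`. Closure under direct sums follows, see `IsWeaklyClosed.prop_sigma`. -/
class IsWeaklyClosed (Z : ObjectProperty C) : Prop extends
    Z.IsClosedUnderSubobjects, Z.IsClosedUnderQuotients where
  isLeftAdjoint : Z.ι.IsLeftAdjoint

/-- A closed subspace: a weakly closed subspace whose inclusion functor `i_*` also has a left
adjoint `i^*`. -/
class IsClosedSubspace (Z : ObjectProperty C) : Prop extends IsWeaklyClosed Z where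
  isRightAdjoint : Z.ι.IsRightAdjoint

attribute [instance] IsWeaklyClosed.isLeftAdjoint IsClosedSubspace.isRightAdjoint

/-- The support functor `i^!`, the right adjoint of the inclusion `i_*` of a weakly closed
subspace. -/
noncomputable def supportFunctor (Z : ObjectProperty C) [IsWeaklyClosed Z] :
    C ⥤ Z.FullSubcategory :=
  Z.ι.rightAdjoint

/-- The smallest closed subspace containing all objects of a class `S` (the intersection of all
closed subspaces containing `S`; it is closed, see the instance below). -/
def closedHull (S : ObjectProperty C) : ObjectProperty C := fun M =>
  ∀ Z : ObjectProperty C, IsClosedSubspace Z → S ≤ Z → Z M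

/-- `π[M]`, the smallest closed subspace containing `M`. -/
def closedHullOf (M : C) : ObjectProperty C := closedHull (ObjectProperty.singleton M)

end Subspaces

/-! ### Basic facts: a weakly closed (closed) subspace is closed under coproducts (products), and is
an abelian category; the smallest closed subspace exists -/

section Facts

open scoped ZeroObject

variable {C : Type u} [Category.{v} C]

theorem IsWeaklyClosed.prop_sigma (Z : ObjectProperty C) [IsWeaklyClosed Z] {J : Type w}
    (X : J → C) [HasCoproduct X] (hX : ∀ j, Z (X j)) : Z (∐ X) := by
  let adj := Adjunction.ofIsLeftAdjoint Z.ι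
  let s : (∐ X) ⟶ Z.ι.obj (Z.ι.rightAdjoint.obj (∐ X)) :=
    Sigma.desc fun j => Z.ι.map (adj.homEquiv ⟨X j, hX j⟩ (∐ X) (Sigma.ι X j))
  have hs : s ≫ adj.counit.app (∐ X) = 𝟙 _ := by
    refine Sigma.hom_ext _ _ fun j => ?_
    have := (adj.homEquiv_counit (X := ⟨X j, hX j⟩) (Y := ∐ X)
      (g := adj.homEquiv ⟨X j, hX j⟩ (∐ X) (Sigma.ι X j))).symm
    simp only [Equiv.symm_apply_apply] at this
    simp only [s, Sigma.ι_desc_assoc, Category.comp_id]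
    exact this
  have : Mono s := ⟨fun a b h => by
    simpa [hs] using congrArg (fun t => t ≫ adj.counit.app (∐ X)) h⟩
  exact Z.prop_of_mono s (ObjectProperty.FullSubcategory.property _)

theorem IsClosedSubspace.prop_pi (Z : ObjectProperty C) [IsClosedSubspace Z] {J : Type w}
    (X : J → C) [HasProduct X] (hX : ∀ j, Z (X j)) : Z (∏ᶜ X) := by
  let adj := Adjunction.ofIsRightAdjoint Z.ι
  let s : Z.ι.obj (Z.ι.leftAdjoint.obj (∏ᶜ X)) ⟶ ∏ᶜ X :=
    Pi.lift fun j => Z.ι.map ((adj.homEquiv (∏ᶜ X) ⟨X j, hX j⟩).symm (Pi.π X j))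
  have hs : adj.unit.app (∏ᶜ X) ≫ s = 𝟙 _ := by
    refine Pi.hom_ext _ _ fun j => ?_
    have := (adj.homEquiv_unit (X := ∏ᶜ X) (Y := ⟨X j, hX j⟩)
      (f := (adj.homEquiv (∏ᶜ X) ⟨X j, hX j⟩).symm (Pi.π X j))).symm
    simp only [Equiv.apply_symm_apply] at this
    simp only [s, Category.assoc, Pi.lift_π, Category.id_comp]
    exact this
  have : Epi s := ⟨fun a b h => by
    simpa [reassoc_of% hs] using congrArg (fun t => adj.unit.app (∏ᶜ X) ≫ t) h⟩
  exact Z.prop_of_epi s (ObjectProperty.FullSubcategory.property _)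

variable [Abelian C]

instance (Z : ObjectProperty C) [IsWeaklyClosed Z] : Z.ContainsZero where
  exists_zero := ⟨_, isZero_zero C,
    Z.prop_of_mono (0 : (0 : C) ⟶ Z.ι.obj (Z.ι.rightAdjoint.obj 0))
      (ObjectProperty.FullSubcategory.property _)⟩

instance (Z : ObjectProperty C) [IsWeaklyClosed Z] : Z.IsClosedUnderFiniteProducts where
  isClosedUnderLimitsOfShape J _ := by
    refine .mk' ?_
    rintro _ ⟨F, hF⟩
    have : HasBiproduct fun j : J => F.obj ⟨j⟩ := HasBiproduct.of_hasProduct _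
    have e : limit F ≅ ∐ fun j : J => F.obj ⟨j⟩ :=
      HasLimit.isoOfNatIso (Discrete.natIsoFunctor (F := F)) ≪≫
        (biproduct.isoProduct fun j : J => F.obj ⟨j⟩).symm ≪≫ biproduct.isoCoproduct _
    exact Z.prop_of_iso e.symm (IsWeaklyClosed.prop_sigma Z _ fun j => hF ⟨j⟩)

variable [IsGrothendieckAbelian.{v} C]

theorem isLeftAdjoint_of_prop_sigma (Z : ObjectProperty C) [Z.IsClosedUnderSubobjects]
    [Z.IsClosedUnderQuotients]
    (h : ∀ (J : Type v) (X : J → C), (∀ j, Z (X j)) → Z (∐ X)) : Z.ι.IsLeftAdjoint := by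
  rw [isLeftAdjoint_iff_hasTerminal_costructuredArrow]
  intro M
  let J : Type v := Shrink.{v} {N : Subobject M // Z (N : C)}
  let X : J → C := fun j => (((equivShrink _).symm j).1 : C)
  let d : (∐ X) ⟶ M := Sigma.desc fun j => ((equivShrink _).symm j).1.arrow
  have hX : Z (image d) := Z.prop_of_epi (factorThruImage d) (h J X fun j =>
    ((equivShrink {N : Subobject M // Z (N : C)}).symm j).2)
  let T : CostructuredArrow Z.ι M :=
    CostructuredArrow.mk (show Z.ι.obj ⟨image d, hX⟩ ⟶ M from image.ι d)
  have key : ∀ A : CostructuredArrow Z.ι M, ∃ k : A.left.obj ⟶ image d, k ≫ image.ι d = A.hom := by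
    intro A
    let N : Subobject M := imageSubobject A.hom
    have hN : Z (N : C) := Z.prop_of_epi (factorThruImageSubobject A.hom) A.left.property
    let j : J := equivShrink _ ⟨N, hN⟩
    have hj : (equivShrink {N : Subobject M // Z (N : C)}).symm j = ⟨N, hN⟩ := by simp [j]
    have : ∃ l : (N : C) ⟶ image d, l ≫ image.ι d = N.arrow := by
      have h2 : ∃ l : (((equivShrink {N : Subobject M // Z (N : C)}).symm j).1 : C) ⟶ image d,
          l ≫ image.ι d = ((equivShrink {N : Subobject M // Z (N : C)}).symm j).1.arrow :=
        ⟨Sigma.ι X j ≫ factorThruImage d, by simp [d, X]⟩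
      rw [hj] at h2
      exact h2
    obtain ⟨l, hl⟩ := this
    refine ⟨factorThruImageSubobject A.hom ≫ l, ?_⟩
    rw [Category.assoc, hl]
    exact imageSubobject_arrow_comp A.hom
  have ht : IsTerminal T := IsTerminal.ofUniqueHom
    (fun A => CostructuredArrow.homMk (Z.homMk (key A).choose) (key A).choose_spec)
    (fun A m => by
      refine CostructuredArrow.hom_ext _ _ ?_
      ext
      rw [← cancel_mono (image.ι d)]
      exact (CostructuredArrow.w m).trans (key A).choose_spec.symm)
  exact ht.hasTerminal

theorem isRightAdjoint_of_prop_pi (Z : ObjectProperty C) [Z.IsClosedUnderSubobjects]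
    [Z.IsClosedUnderQuotients]
    (h : ∀ (J : Type v) (X : J → C), (∀ j, Z (X j)) → Z (∏ᶜ X)) : Z.ι.IsRightAdjoint := by
  rw [isRightAdjoint_iff_hasInitial_structuredArrow]
  intro M
  let J : Type v := Shrink.{v} {N : Subobject M // Z (cokernel N.arrow)}
  let X : J → C := fun j => cokernel ((equivShrink _).symm j).1.arrow
  let d : M ⟶ ∏ᶜ X := Pi.lift fun j => cokernel.π ((equivShrink _).symm j).1.arrow
  have hX : Z (image d) := Z.prop_of_mono (image.ι d) (h J X fun j =>
    ((equivShrink {N : Subobject M // Z (cokernel N.arrow)}).symm j).2)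
  let T : StructuredArrow M Z.ι :=
    StructuredArrow.mk (show M ⟶ Z.ι.obj ⟨image d, hX⟩ from factorThruImage d)
  have key : ∀ A : StructuredArrow M Z.ι,
      ∃ k : image d ⟶ A.right.obj, factorThruImage d ≫ k = A.hom := by
    intro A
    let f : M ⟶ A.right.obj := A.hom
    let N : Subobject M := kernelSubobject f
    have hf : N.arrow ≫ f = 0 := kernelSubobject_arrow_comp f
    let g : cokernel N.arrow ⟶ A.right.obj := cokernel.desc N.arrow f hf
    have hg : Mono g := by
      have e : N.arrow = (kernelSubobjectIso f).hom ≫ kernel.ι f := by simp [N]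
      refine Preadditive.mono_of_cancel_zero _ fun {G} a ha => ?_
      obtain ⟨W, p, hp, b, hb⟩ :=
        surjective_up_to_refinements_of_epi (cokernel.π N.arrow) a
      have hbf : b ≫ f = 0 := by
        have : b ≫ cokernel.π N.arrow ≫ g = 0 := by
          rw [← Category.assoc, ← hb, Category.assoc, ha, comp_zero]
        simpa [g] using this
      have hb' : b = (kernel.lift f b hbf ≫ (kernelSubobjectIso f).inv) ≫ N.arrow := by
        simp [e]
      rw [← cancel_epi p, hb, hb', Category.assoc, cokernel.condition, comp_zero, comp_zero]
    have hN : Z (cokernel N.arrow) := Z.prop_of_mono g A.right.property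
    let j : J := equivShrink _ ⟨N, hN⟩
    have hj : (equivShrink {N : Subobject M // Z (cokernel N.arrow)}).symm j = ⟨N, hN⟩ := by
      simp [j]
    have : ∃ l : image d ⟶ cokernel N.arrow, factorThruImage d ≫ l = cokernel.π N.arrow := by
      have h2 : ∃ l : image d ⟶
          cokernel ((equivShrink {N : Subobject M // Z (cokernel N.arrow)}).symm j).1.arrow,
          factorThruImage d ≫ l = cokernel.π
            ((equivShrink {N : Subobject M // Z (cokernel N.arrow)}).symm j).1.arrow :=
        ⟨image.ι d ≫ Pi.π X j, by rw [image.fac_assoc]; simp [d, X]⟩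
      rw [hj] at h2
      exact h2
    obtain ⟨l, hl⟩ := this
    exact ⟨l ≫ g, by rw [← Category.assoc, hl]; simp [g, f]⟩
  have ht : IsInitial T := IsInitial.ofUniqueHom
    (fun A => StructuredArrow.homMk (Z.homMk (key A).choose) (key A).choose_spec)
    (fun A m => by
      refine StructuredArrow.hom_ext _ _ ?_
      ext
      rw [← cancel_epi (factorThruImage d)]
      exact (StructuredArrow.w m).trans (key A).choose_spec.symm)
  exact ht.hasInitial

/-- `closedHull S` is a closed subspace. -/
instance (S : ObjectProperty C) : IsClosedSubspace (closedHull S) :=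
  have : (closedHull S).IsClosedUnderSubobjects :=
    ⟨fun f _ hY Z hZ hS => Z.prop_of_mono f (hY Z hZ hS)⟩
  have : (closedHull S).IsClosedUnderQuotients :=
    ⟨fun f _ hX Z hZ hS => Z.prop_of_epi f (hX Z hZ hS)⟩
  { isLeftAdjoint := isLeftAdjoint_of_prop_sigma _ fun _ X hX Z hZ hS =>
      IsWeaklyClosed.prop_sigma Z X fun j => hX j Z hZ hS
    isRightAdjoint := isRightAdjoint_of_prop_pi _ fun _ X hX Z hZ hS =>
      IsClosedSubspace.prop_pi Z X fun j => hX j Z hZ hS }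

end Facts

/-! ### The injective spectrum and the weak Zariski topology -/

section Spectrum

/-- The indecomposable injective objects of an abelian category. -/
structure IndecInj (C : Type u) [Category.{v} C] [Abelian C] where
  /-- The underlying object. -/
  obj : C
  injective : Injective obj
  indecomposable : Indecomposable obj

/-- Two indecomposable injectives are equivalent if they are isomorphic. -/
instance IndecInj.setoid (C : Type u) [Category.{v} C] [Abelian C] : Setoid (IndecInj C) where
  r E F := Nonempty (E.obj ≅ F.obj)
  iseqv := ⟨fun _ => ⟨Iso.refl _⟩, fun ⟨e⟩ => ⟨e.symm⟩, fun ⟨e⟩ ⟨f⟩ => ⟨e ≪≫ f⟩⟩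

/-- The injective spectrum `Inj(X)`: the set of isomorphism classes of indecomposable
injectives. -/
def Inj (C : Type u) [Category.{v} C] [Abelian C] : Type u :=
  Quotient (IndecInj.setoid C)

variable {C : Type u} [Category.{v} C] [Abelian C]

/-- The isomorphism class `[E]` of an indecomposable injective. -/
def IndecInj.toInj (E : IndecInj C) : Inj C := Quotient.mk _ E

/-- The set `V(Z) = {[E] : i^! E ≠ 0}` attached to a weakly closed subspace `Z`. -/
def supportSet (Z : ObjectProperty C) [IsWeaklyClosed Z] : Set (Inj C) :=
  {x | ∃ E : IndecInj C, E.toInj = x ∧ ¬ IsZero ((supportFunctor Z).obj E.obj)}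

/-- The weak Zariski topology: the topology generated by declaring the sets `V(Z)`, with `Z` weakly
closed, to be closed. -/
instance : TopologicalSpace (Inj C) :=
  TopologicalSpace.generateFrom
    {U | ∃ (Z : ObjectProperty C) (_ : IsWeaklyClosed Z), U = (supportSet Z)ᶜ}

/-- A space is topologically irreducible if its injective spectrum is an irreducible (in particular
nonempty) topological space. -/
def TopologicallyIrreducible (C : Type u) [Category.{v} C] [Abelian C] : Prop :=
  IrreducibleSpace (Inj C)

/-- The morphism `f : M ⟶ E` exhibits `E` as an injective hull `E(M)` of `M`: `E` is injective and
`f` is an essential monomorphism. -/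
structure IsInjectiveHull {M E : C} (f : M ⟶ E) : Prop where
  injective : Injective E
  mono : Mono f
  essential : ∀ N : Subobject E, N ⊓ Subobject.mk f = ⊥ → N = ⊥

/-- `φ` is the map `Inj(Z) → Inj(X)` induced by the inclusion `i` of a weakly closed subspace `Z`
of `X`, that is, `φ [E] = [E(i_* E)]`: the class `φ [E]` consists of the injective hulls
of `i_* E`. -/
def IsInducedMap (Z : ObjectProperty C) [IsWeaklyClosed Z]
    (φ : Inj Z.FullSubcategory → Inj C) : Prop :=
  ∀ (E : IndecInj Z.FullSubcategory) (F : IndecInj C),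
    φ E.toInj = F.toInj ↔ ∃ f : Z.ι.obj E.obj ⟶ F.obj, IsInjectiveHull f

end Spectrum

/-! ### Locally noetherian spaces, prime modules and the reduced subspace -/

section Prime

variable {C : Type u} [Category.{v} C] [Abelian C]

/-- A space is locally noetherian if it has a (small) set of noetherian generators. -/
def LocallyNoetherian (C : Type u) [Category.{v} C] : Prop :=
  ∃ S : ObjectProperty C, ObjectProperty.Small.{v} S ∧ S ≤ isNoetherianObject ∧ S.IsSeparating

/-- A module `M` is prime if `π[N] = π[M]` for every nonzero `N ≤ M`. -/
def IsPrimeModule (M : C) : Prop :=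
  ∀ N : Subobject M, N ≠ ⊥ → closedHullOf M = closedHullOf (N : C)

/-- A space has enough prime modules if every nonzero module has a nonzero prime submodule. -/
def EnoughPrimeModules (C : Type u) [Category.{v} C] [Abelian C] : Prop :=
  ∀ M : C, ¬ IsZero M → ∃ N : Subobject M, N ≠ ⊥ ∧ IsPrimeModule (N : C)

/-- `X_red`, the smallest closed subspace containing all prime modules. -/
def redSubspace (C : Type u) [Category.{v} C] [Abelian C] : ObjectProperty C :=
  closedHull IsPrimeModule

instance [IsGrothendieckAbelian.{v} C] : IsClosedSubspace (redSubspace C) :=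
  inferInstanceAs (IsClosedSubspace (closedHull _))

end Prime

/-! ### Prime rings and the prime radical -/

section Rings

variable (R : Type w) [Ring R]

/-- A ring is prime if it is nonzero and `a R b = 0` implies `a = 0` or `b = 0`. -/
def IsPrimeRing : Prop :=
  Nontrivial R ∧ ∀ a b : R, (∀ r : R, a * r * b = 0) → a = 0 ∨ b = 0

variable {R} in
/-- A two-sided ideal `P` is prime if it is proper and `a R b ⊆ P` implies `a ∈ P` or `b ∈ P`. -/
def IsPrimeIdeal (P : TwoSidedIdeal R) : Prop :=
  P ≠ ⊤ ∧ ∀ a b : R, (∀ r : R, a * r * b ∈ P) → a ∈ P ∨ b ∈ P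

/-- `Nil(R)`, the intersection of all prime (two-sided) ideals of `R`. -/
def primeRadical : TwoSidedIdeal R := sInf {P | IsPrimeIdeal P}

end Rings

end NCSpace

open CategoryTheory CategoryTheory.Limits

/-! (a) For any closed subspace `Z` the induced map is a topological embedding with image `V(Z)`. An
injective object is indecomposable exactly when it is uniform, and a uniform object of `Z` stays
uniform in `X`, so the hull `F` of `i_* E` is again indecomposable. Conversely `i^! F` recovers `E`,
because the hull in `Z` is the part of the ambient hull supported on `Z`. Weakly closed subspaces
restrict from `X` to `Z` and extend from `Z` to `X`, which matches the subbasic closed sets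
(`IsInducedMap.range_eq`, `IsInducedMap.isInducing`). With enough primes every indecomposable
injective contains a nonzero prime module, so `V(X_red)` is everything.

(b) Every indecomposable injective has a nonzero submodule killed by a prime ideal
(`exists_isPrimeIdeal_annihilator`). If `a R b ⊆ Nil(R)`, each prime contains `a` or `b`, so the
supports of the modules killed by `a` and by `b` cover the spectrum. Irreducibility makes one of
them everything, and testing on the modules `R/P` puts `a` or `b` in every prime. Conversely, if `S
= R/Nil(R)` is prime, the hull of a uniform right ideal of `S` is a generic point. A weakly closed
`Z` supporting it contains a nonzero right ideal of `S`; `S` embeds in a finite power of that ideal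
(`IsPrimeRing.exists_finset_annihilator`), so `S` lies in `Z`. Every indecomposable injective
receives a nonzero map from `S`, hence is supported on `Z`. -/

namespace NCSpace

/-! ### Essential monomorphisms, uniform objects and injective hulls -/

section Essential

variable {C : Type u} [Category.{v} C]

/-- A monomorphism `f` is essential if `g` is mono whenever `f ≫ g` is. -/
structure EssentialMono {M E : C} (f : M ⟶ E) : Prop where
  mono : Mono f
  mono_of_comp : ∀ ⦃Y : C⦄ (g : E ⟶ Y), Mono (f ≫ g) → Mono g

theorem EssentialMono.comp {M E F : C} {f : M ⟶ E} {g : E ⟶ F} (hf : EssentialMono f)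
    (hg : EssentialMono g) : EssentialMono (f ≫ g) :=
  ⟨have := hf.mono; have := hg.mono; inferInstance, fun _ k hk =>
    hg.mono_of_comp k (hf.mono_of_comp _ (by simpa using hk))⟩

theorem EssentialMono.of_isIso {M E : C} (f : M ⟶ E) [IsIso f] : EssentialMono f :=
  ⟨inferInstance, fun _ g _ => by
    have : g = inv f ≫ f ≫ g := by simp
    rw [this]; infer_instance⟩

theorem EssentialMono.of_comp_right {M E F : C} {f : M ⟶ E} {g : E ⟶ F} [Mono f] [Mono g]
    (h : EssentialMono (f ≫ g)) : EssentialMono g :=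
  ⟨inferInstance, fun _ k hk => h.mono_of_comp k (by
    rw [Category.assoc]; exact mono_comp f (g ≫ k))⟩

variable [Abelian C]

/-- A test morphism `k` out of `E` is pushed out along `g`; pushouts of monomorphisms are
monomorphisms, so essentiality of the composite applies. -/
theorem EssentialMono.of_comp_left {M E F : C} {f : M ⟶ E} {g : E ⟶ F} [Mono f] [Mono g]
    (h : EssentialMono (f ≫ g)) : EssentialMono f :=
  ⟨inferInstance, fun Y k hk => by
    have h1 : Mono ((f ≫ g) ≫ pushout.inr k g) := by
      rw [Category.assoc, ← pushout.condition, ← Category.assoc]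
      exact mono_comp _ _
    have h2 := h.mono_of_comp _ h1
    have h3 : Mono (k ≫ pushout.inl k g) := by
      rw [pushout.condition]; exact mono_comp _ _
    exact mono_of_mono k (pushout.inl k g)⟩

/-- Zero intersection of `A` and `B` is encoded by `B ⟶ E/A` being mono, which is the form that
essentiality can use. -/
theorem mono_comp_cokernel_of_disjoint {A B E : C} (a : A ⟶ E) (b : B ⟶ E) [Mono a] [Mono b]
    (h : ∀ ⦃T : C⦄ (x : T ⟶ A) (y : T ⟶ B), x ≫ a = y ≫ b → x = 0) :
    Mono (b ≫ cokernel.π a) := by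
  refine Preadditive.mono_of_cancel_zero _ fun {T} x hx => ?_
  have e : Abelian.monoLift a (x ≫ b) (by simpa using hx) ≫ a = x ≫ b :=
    Abelian.monoLift_comp _ _ _
  have h0 := h _ _ e
  rw [h0, zero_comp] at e
  exact zero_of_comp_mono b e.symm

theorem disjoint_of_mono_comp_cokernel {A B E : C} (a : A ⟶ E) (b : B ⟶ E) [Mono b]
    [Mono (a ≫ cokernel.π b)] ⦃T : C⦄ (x : T ⟶ A) (y : T ⟶ B) (h : x ≫ a = y ≫ b) : x = 0 :=
  zero_of_comp_mono (a ≫ cokernel.π b) (by rw [reassoc_of% h]; simp)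

theorem mono_comp_cokernel_symm {A B E : C} (a : A ⟶ E) (b : B ⟶ E) [Mono a] [Mono b]
    [Mono (a ≫ cokernel.π b)] : Mono (b ≫ cokernel.π a) :=
  mono_comp_cokernel_of_disjoint a b fun _ x y h => disjoint_of_mono_comp_cokernel a b x y h

/-- The witness is the intersection of `A` and `M`. Were it zero, `M ⟶ E/A` would be mono, hence so
would `E ⟶ E/A`, forcing `a = 0`. -/
theorem EssentialMono.exists_ne_zero {M E A : C} {f : M ⟶ E} (hf : EssentialMono f) (a : A ⟶ E)
    [Mono a] (ha : a ≠ 0) : ∃ (T : C) (x : T ⟶ A) (y : T ⟶ M),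
      Mono x ∧ Mono y ∧ x ≫ a = y ≫ f ∧ x ≫ a ≠ 0 := by
  have := hf.mono
  refine ⟨pullback a f, pullback.fst a f, pullback.snd a f, inferInstance, inferInstance,
    pullback.condition, fun h0 => ha ?_⟩
  have h1 : Mono (f ≫ cokernel.π a) := mono_comp_cokernel_of_disjoint a f fun T x y h => by
    have h2 : pullback.fst a f = 0 := zero_of_comp_mono a h0
    rw [← pullback.lift_fst x y h, h2, comp_zero]
  have h2 := hf.mono_of_comp _ h1
  exact zero_of_comp_mono (cokernel.π a) (cokernel.condition a)

theorem isInjectiveHull_iff {M E : C} (f : M ⟶ E) :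
    IsInjectiveHull f ↔ Injective E ∧ EssentialMono f := by
  constructor
  · rintro ⟨h1, h2, h3⟩
    refine ⟨h1, h2, fun Y g hg => ?_⟩
    have h := h3 (kernelSubobject g) <| by
      rw [eq_bot_iff, ← Subobject.mk_arrow (kernelSubobject g ⊓ Subobject.mk f), ← eq_bot_iff,
        Subobject.mk_eq_bot_iff_zero]
      set P := kernelSubobject g ⊓ Subobject.mk f
      have e : Subobject.ofLEMk P f inf_le_right ≫ f = P.arrow := Subobject.ofLEMk_comp _
      have e2 : P.arrow ≫ g = 0 := by
        rw [← Subobject.ofLE_arrow (inf_le_left : P ≤ kernelSubobject g), Category.assoc,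
          kernelSubobject_arrow_comp, comp_zero]
      have e3 : Subobject.ofLEMk P f inf_le_right = 0 :=
        zero_of_comp_mono (f ≫ g) (by rw [reassoc_of% e, e2])
      rw [← e, e3, zero_comp]
    refine Preadditive.mono_of_cancel_zero _ fun {T} x hx => ?_
    have h4 : (kernelSubobject g).arrow = 0 := by
      rw [← Subobject.mk_eq_bot_iff_zero, Subobject.mk_arrow, h]
    rw [← factorThruKernelSubobject_comp_arrow g x hx, h4, comp_zero]
  · rintro ⟨h1, h2⟩
    refine ⟨h1, h2.mono, fun N hN => ?_⟩
    by_contra hne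
    have hne' : N.arrow ≠ 0 := by
      rwa [Ne, ← Subobject.mk_eq_bot_iff_zero, Subobject.mk_arrow]
    obtain ⟨T, x, y, hx, hy, e, h0⟩ := h2.exists_ne_zero N.arrow hne'
    have := h2.mono
    apply h0
    rw [← Subobject.mk_eq_bot_iff_zero, ← le_bot_iff, ← hN]
    exact le_inf (Subobject.mk_le_of_comm x rfl) (Subobject.mk_le_mk_of_comm y e.symm)

/-- A nonzero object is uniform if all its nonzero subobjects are essential. -/
structure Uniform (U : C) : Prop where
  not_isZero : ¬ IsZero U
  essential : ∀ ⦃A : C⦄ (a : A ⟶ U), Mono a → a ≠ 0 → EssentialMono a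

theorem Uniform.of_mono {A U : C} (hU : Uniform U) (a : A ⟶ U) [Mono a] (hA : ¬ IsZero A) :
    Uniform A :=
  ⟨hA, fun _ b _ h => (hU.essential (b ≫ a) inferInstance fun h0 =>
    h (zero_of_comp_mono a h0)).of_comp_left⟩

theorem Uniform.of_essentialMono {U E : C} (hU : Uniform U) {f : U ⟶ E} (hf : EssentialMono f) :
    Uniform E := by
  have := hf.mono
  refine ⟨fun hE => hU.not_isZero (IsZero.of_mono f hE), fun A a _ ha => ?_⟩
  obtain ⟨T, x, y, hx, hy, e, h0⟩ := hf.exists_ne_zero a ha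
  have h := (hU.essential y hy fun hy0 => h0 (by rw [e, hy0, zero_comp])).comp hf
  rw [← e] at h
  exact h.of_comp_right

/-- A nonzero summand is essential, so the projection onto it is mono and its complement vanishes.
-/
theorem Uniform.indecomposable {U : C} (hU : Uniform U) : Indecomposable U := by
  refine ⟨hU.not_isZero, fun Y Z e => ?_⟩
  by_contra! h
  have h1 : Mono ((biprod.inl : Y ⟶ Y ⊞ Z) ≫ e.inv) := inferInstance
  have h2 := hU.essential _ h1 fun h0 => h.1 <| by
    rw [IsZero.iff_id_eq_zero]
    simpa using congrArg (fun t => t ≫ e.hom ≫ biprod.fst) h0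
  have h3 := h2.mono_of_comp (e.hom ≫ biprod.fst) (by simp; infer_instance)
  have h4 : (biprod.inr : Z ⟶ Y ⊞ Z) ≫ e.inv = 0 :=
    zero_of_comp_mono (e.hom ≫ biprod.fst) (by simp)
  refine h.2 ?_
  rw [IsZero.iff_id_eq_zero]
  simpa using congrArg (fun t => t ≫ e.hom ≫ biprod.snd) h4

theorem isIso_of_indecomposable {E F : C} (hE : Indecomposable E) (hF : ¬ IsZero F)
    (k : F ⟶ E) [Mono k] [Injective F] : IsIso k := by
  let r := Injective.factorThru (𝟙 F) k
  have hr : k ≫ r = 𝟙 F := Injective.comp_factorThru _ _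
  let S : ShortComplex C := ShortComplex.mk k (cokernel.π k) (by simp)
  have hS : S.Exact := S.exact_of_g_is_cokernel (cokernelIsCokernel k)
  have : Epi S.g := inferInstanceAs (Epi (cokernel.π k))
  let s : S.Splitting := ShortComplex.Splitting.ofExactOfRetraction S hS r hr inferInstance
  have e : E ≅ F ⊞ cokernel k := s.isoBinaryBiproduct
  have hz := (hE.2 _ _ e).resolve_left hF
  have : Epi k := Preadditive.epi_of_isZero_cokernel k hz
  exact isIso_of_mono_of_epi k

omit [Abelian C] in
theorem EssentialMono.exists_iso {M E E' : C} {f : M ⟶ E} {f' : M ⟶ E'} (hf : EssentialMono f)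
    (hf' : EssentialMono f') [Injective E] [Injective E'] :
    ∃ e : E ≅ E', f ≫ e.hom = f' := by
  have := hf.mono
  have := hf'.mono
  let g : E ⟶ E' := Injective.factorThru f' f
  have hg : f ≫ g = f' := Injective.comp_factorThru _ _
  have : Mono g := hf.mono_of_comp g (by rwa [hg])
  let r := Injective.factorThru (𝟙 E) g
  have hr : g ≫ r = 𝟙 E := Injective.comp_factorThru _ _
  have : Mono r := hf'.mono_of_comp r (by rw [← hg, Category.assoc, hr, Category.comp_id]; assumption)
  have : IsSplitEpi r := ⟨⟨⟨g, hr⟩⟩⟩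
  have : IsIso r := isIso_of_mono_of_isSplitEpi r
  have : IsIso g := by
    have : g = inv r := by rw [← cancel_mono r]; simp [hr]
    rw [this]; infer_instance
  exact ⟨asIso g, hg⟩

variable (C) in
/-- Every object has an injective hull. -/
def HasInjectiveHulls : Prop :=
  ∀ M : C, ∃ (E : C) (f : M ⟶ E), Injective E ∧ EssentialMono f

/-- The hull of a nonzero subobject embeds in `E` as a direct summand, hence is all of `E`. -/
theorem HasInjectiveHulls.uniform (hC : HasInjectiveHulls C) {E : C} [Injective E]
    (hE : Indecomposable E) : Uniform E := by
  refine ⟨hE.1, fun A a _ ha => ?_⟩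
  obtain ⟨F, h, hF, hh⟩ := hC A
  have := hh.mono
  let k : F ⟶ E := Injective.factorThru a h
  have hk : h ≫ k = a := Injective.comp_factorThru _ _
  have : Mono k := hh.mono_of_comp k (by rw [hk]; assumption)
  have : IsIso k := isIso_of_indecomposable hE (fun h0 => ha (by
    rw [← hk, h0.eq_of_tgt h 0, zero_comp])) k
  rw [← hk]
  exact hh.comp (.of_isIso k)

end Essential

/-! ### Existence of injective hulls in a Grothendieck category -/

section Hulls

variable {C : Type u} [Category.{v} C] [Abelian C] [IsGrothendieckAbelian.{v} C]

/-- This is AB5: the union is a filtered colimit of the members, and filtered colimits preserve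
monomorphisms. -/
theorem mono_sSup_arrow_comp {I Q : C} (S : Set (Subobject I)) (hne : S.Nonempty)
    (hS : DirectedOn (· ≤ ·) S) (g : I ⟶ Q) (h : ∀ N ∈ S, Mono (N.arrow ≫ g)) :
    Mono ((sSup S).arrow ≫ g) := by
  let J : Type v := Shrink.{v} S
  let σ : J → Subobject I := fun j => ((equivShrink S).symm j).1
  let _ : Preorder J := Preorder.lift σ
  let _ : SmallCategory J := Preorder.smallCategory J
  have : Nonempty J := ⟨equivShrink S ⟨_, hne.choose_spec⟩⟩
  have : IsDirectedOrder J := ⟨fun i j => by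
    obtain ⟨k, hk, h1, h2⟩ := hS _ ((equivShrink S).symm i).2 _ ((equivShrink S).symm j).2
    refine ⟨equivShrink S ⟨k, hk⟩, ?_, ?_⟩
    · change ((equivShrink S).symm i).1 ≤ ((equivShrink S).symm _).1
      simpa using h1
    · change ((equivShrink S).symm j).1 ≤ ((equivShrink S).symm _).1
      simpa using h2⟩
  have hσ : Monotone σ := fun _ _ h => h
  let F : J ⥤ MonoOver I :=
    { obj j := Subobject.representative.obj (σ j)
      map t := Subobject.representative.map (homOfLE (hσ (leOfHom t))) }
  let G : J ⥤ C := F ⋙ MonoOver.forget _ ⋙ Over.forget _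
  let α : G ⟶ (Functor.const J).obj I :=
    { app j := (F.obj j).obj.hom
      naturality i j t := by simp [G] }
  let f : colimit G ⟶ I := colimit.desc G ⟨I, α⟩
  have hf : ∀ j, colimit.ι G j ≫ f = (F.obj j).obj.hom := fun j => colimit.ι_desc _ _
  have hm : Mono f := IsGrothendieckAbelian.mono_of_isColimit_monoOver F (colimit.isColimit G) f hf
  have hsup := IsGrothendieckAbelian.subobjectMk_of_isColimit_eq_iSup F (colimit.isColimit G) f hf
  have hsup' : Subobject.mk f = sSup S := by
    rw [hsup, sSup_eq_iSup', ← (equivShrink S).symm.iSup_comp]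
    exact iSup_congr fun j => Subobject.mk_arrow _
  have : ∀ j, Mono ((F.obj j).obj.hom ≫ g) := fun j => h _ ((equivShrink S).symm j).2
  let β : G ⟶ (Functor.const J).obj Q := α ≫ (Functor.const J).map g
  have hβ : Mono β := by
    have : ∀ j, Mono (β.app j) := this
    exact NatTrans.mono_of_mono_app β
  have : Mono (f ≫ g) := by
    have := IsFiltered.isConnected J
    exact colim.map_mono' β (colimit.isColimit G) (isColimitConstCocone J Q) (f ≫ g) (fun j =>
      (Category.assoc _ _ _).symm.trans (((hf j) =≫ g).trans (Category.comp_id _).symm))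
  rw [← hsup', ← Subobject.underlyingIso_hom_comp_eq_mk, Category.assoc]
  exact mono_comp _ _

/-- By Zorn, take `K` maximal with `K ∩ M = 0` and let `p` be the quotient by `K`. If `g` is mono on
`M`, the kernel of `p ≫ g` still meets `M` trivially, so it equals `K`. -/
theorem exists_essentialMono_comp {M I : C} (m : M ⟶ I) [Mono m] :
    ∃ (Q : C) (p : I ⟶ Q), EssentialMono (m ≫ p) := by
  obtain ⟨K, -, hK⟩ := zorn_le_nonempty₀ {K : Subobject I | Mono (m ≫ cokernel.π K.arrow)}
    (fun c hc hch y hy => by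
      refine ⟨sSup c, ?_, fun z hz => le_sSup hz⟩
      have : Mono ((sSup c).arrow ≫ cokernel.π m) :=
        mono_sSup_arrow_comp c ⟨y, hy⟩ hch.directedOn _ fun N hN => by
          have : Mono (m ≫ cokernel.π N.arrow) := hc hN
          exact mono_comp_cokernel_symm m N.arrow
      exact mono_comp_cokernel_symm (sSup c).arrow m) ⊥ (by
      have : cokernel.π (⊥ : Subobject I).arrow ≫
          cokernel.desc (⊥ : Subobject I).arrow (𝟙 I) (by simp) = 𝟙 I := by simp
      have : Mono (cokernel.π (⊥ : Subobject I).arrow) := mono_of_mono_fac this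
      exact mono_comp _ _)
  have hmono : Mono (m ≫ cokernel.π K.arrow) := hK.prop
  refine ⟨_, cokernel.π K.arrow, hmono, fun Y g hg => ?_⟩
  let p := cokernel.π K.arrow
  let K' := kernelSubobject (p ≫ g)
  have hK' : Mono (m ≫ cokernel.π K'.arrow) := by
    have e : (m ≫ cokernel.π K'.arrow) ≫
        cokernel.desc K'.arrow (p ≫ g) (kernelSubobject_arrow_comp _) = (m ≫ p) ≫ g := by simp
    have : Mono ((m ≫ p) ≫ g) := hg
    exact mono_of_mono_fac e
  have hle : K ≤ K' := le_kernelSubobject _ _ (by simp [p])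
  have hle' : K' ≤ K := hK.le_of_ge hK' hle
  refine Preadditive.mono_of_cancel_zero _ fun {T} x hx => ?_
  obtain ⟨W, π, hπ, y, hy⟩ := surjective_up_to_refinements_of_epi p x
  have h0 : y ≫ p ≫ g = 0 := by
    rw [← Category.assoc, ← hy, Category.assoc, hx, comp_zero]
  have h1 : y ≫ p = 0 := by
    rw [← factorThruKernelSubobject_comp_arrow (p ≫ g) y h0, ← Subobject.ofLE_arrow hle']
    simp only [p, Category.assoc, cokernel.condition, comp_zero]
  rw [← cancel_epi π, hy, h1, comp_zero]

theorem hasInjectiveHulls : HasInjectiveHulls C := by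
  intro M
  let I := Injective.under M
  let m : M ⟶ I := Injective.ι M
  -- `N` is a maximal essential extension of `M` inside the injective `I`; it is shown to be a
  -- retract of `I`.
  obtain ⟨N, -, hN⟩ := zorn_le_nonempty₀
    {N : Subobject I | ∃ h : M ⟶ (N : C), h ≫ N.arrow = m ∧ EssentialMono h}
    (fun c hc hch y hy => by
      obtain ⟨h, e, hh⟩ := hc hy
      have hle : ∀ z ∈ c, z ≤ sSup c := fun z hz => le_sSup hz
      refine ⟨sSup c, ⟨h ≫ Subobject.ofLE _ _ (hle y hy), by simpa using e, ?_, ?_⟩, hle⟩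
      · have := hh.mono
        exact mono_comp _ _
      · intro Y g hg
        have h1 : Mono ((sSup c).arrow ≫ pushout.inr g (sSup c).arrow) := by
          refine mono_sSup_arrow_comp c ⟨y, hy⟩ hch.directedOn _ fun N hN => ?_
          obtain ⟨k, ek, hk⟩ := hc hN
          have e1 : k ≫ Subobject.ofLE _ _ (hle N hN) = h ≫ Subobject.ofLE _ _ (hle y hy) := by
            rw [← cancel_mono (sSup c).arrow]
            simp [e, ek]
          have h2 : Mono (Subobject.ofLE _ _ (hle N hN) ≫ g) :=
            hk.mono_of_comp _ (by rw [reassoc_of% e1]; simpa using hg)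
          rw [← Subobject.ofLE_arrow (hle N hN), Category.assoc, ← pushout.condition,
            ← Category.assoc]
          exact mono_comp _ _
        rw [← pushout.condition] at h1
        exact mono_of_mono g (pushout.inl g (sSup c).arrow))
    (Subobject.mk m) ⟨(Subobject.underlyingIso m).inv, by simp, .of_isIso _⟩
  obtain ⟨h, e, hh⟩ := hN.prop
  obtain ⟨Q, p, hp⟩ := exists_essentialMono_comp N.arrow
  have := hp.mono
  let k : Q ⟶ I := Injective.factorThru N.arrow (N.arrow ≫ p)
  have hk : (N.arrow ≫ p) ≫ k = N.arrow := Injective.comp_factorThru _ _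
  have : Mono k := hp.mono_of_comp k (by rw [hk]; infer_instance)
  -- The image of `k` is an essential extension of `M` containing `N`, so maximality makes `p ≫ k`
  -- land in `N`.
  have hle : Subobject.mk k ≤ N := hN.le_of_ge
    ⟨(h ≫ N.arrow ≫ p) ≫ (Subobject.underlyingIso k).inv, by
      simpa [e] using h ≫= hk, (hh.comp hp).comp (.of_isIso _)⟩
    (Subobject.le_mk_of_comm (N.arrow ≫ p) hk)
  have e2 : Subobject.ofMkLE k N hle ≫ N.arrow = k := Subobject.ofMkLE_arrow _
  refine ⟨N, h, ?_, hh⟩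
  refine Retract.injective (Y := I) ⟨N.arrow, p ≫ Subobject.ofMkLE k N hle, ?_⟩
  rw [← cancel_mono N.arrow]
  simpa [e2] using hk

end Hulls

/-! ### Supports, and weakly closed subspaces of a closed subspace -/

section Support

variable {C : Type u} [Category.{v} C] [Abelian C]

theorem not_isZero_supportFunctor_iff (Z : ObjectProperty C) [IsWeaklyClosed Z] (E : C) :
    ¬ IsZero ((supportFunctor Z).obj E) ↔ ∃ (A : C) (a : A ⟶ E), Z A ∧ Mono a ∧ a ≠ 0 := by
  let adj : Z.ι ⊣ supportFunctor Z := Adjunction.ofIsLeftAdjoint Z.ι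
  constructor
  · intro h
    by_contra! h0
    have hzero : ∀ (A : Z.FullSubcategory) (f : Z.ι.obj A ⟶ E), f = 0 := fun A f => by
      have := h0 (image f) (image.ι f)
        (Z.prop_of_epi (factorThruImage f) A.property) inferInstance
      rw [← image.fac f, this, comp_zero]
    refine h ((IsZero.iff_id_eq_zero _).2 ((adj.homEquiv _ _).symm.injective ?_))
    rw [hzero _ ((adj.homEquiv _ _).symm _), hzero _ ((adj.homEquiv _ _).symm _)]
  · rintro ⟨A, a, hA, -, ha⟩ h
    exact ha ((adj.homEquiv ⟨A, hA⟩ E).injective (h.eq_of_tgt _ _))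

theorem toInj_eq_iff (E F : IndecInj C) : E.toInj = F.toInj ↔ Nonempty (E.obj ≅ F.obj) :=
  Quotient.eq

theorem toInj_mem_supportSet_iff (Z : ObjectProperty C) [IsWeaklyClosed Z] (E : IndecInj C) :
    E.toInj ∈ supportSet Z ↔ ∃ (A : C) (a : A ⟶ E.obj), Z A ∧ Mono a ∧ a ≠ 0 := by
  rw [← not_isZero_supportFunctor_iff]
  constructor
  · rintro ⟨F, hF, h⟩ h0
    obtain ⟨e⟩ := (toInj_eq_iff F E).1 hF
    exact h (h0.of_iso ((supportFunctor Z).mapIso e))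
  · exact fun h => ⟨E, rfl, h⟩

theorem Inj.exists_rep (x : Inj C) : ∃ E : IndecInj C, E.toInj = x :=
  Quotient.exists_rep x

/-- The kernel of the counit lies in `Z`, and by adjunction its inclusion is determined by its
composite with the counit, which is zero. -/
theorem mono_counit (Z : ObjectProperty C) [IsWeaklyClosed Z] {G : C ⥤ Z.FullSubcategory}
    (adj : Z.ι ⊣ G) (M : C) : Mono (adj.counit.app M) := by
  let c := adj.counit.app M
  have hK : Z (kernel c) := Z.prop_of_mono (kernel.ι c) (G.obj M).property
  let k : (⟨kernel c, hK⟩ : Z.FullSubcategory) ⟶ G.obj M := Z.homMk (kernel.ι c)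
  have hk : k = 0 := (adj.homEquiv _ _).symm.injective (by
    rw [Adjunction.homEquiv_counit, Adjunction.homEquiv_counit]
    exact (kernel.condition c).trans (by simp))
  exact Preadditive.mono_of_kernel_zero (congrArg (fun t => t.hom) hk)

instance isWeaklyClosed_inverseImage (Z W : ObjectProperty C) [IsClosedSubspace Z]
    [IsWeaklyClosed W] : IsWeaklyClosed (W.inverseImage Z.ι) where
  prop_of_mono f _ h := W.prop_of_mono (Z.ι.map f) h
  prop_of_epi f _ h := W.prop_of_epi (Z.ι.map f) h
  isLeftAdjoint := by
    rw [isLeftAdjoint_iff_hasTerminal_costructuredArrow]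
    intro M
    let adj := Adjunction.ofIsLeftAdjoint W.ι
    let c : (W.ι.rightAdjoint.obj M.obj).obj ⟶ M.obj := adj.counit.app M.obj
    have hc : Mono c := mono_counit W adj M.obj
    -- The largest `W`-subobject of an object of `Z` is already in `Z`, so it also serves as the
    -- right adjoint's value inside `Z`.
    have hZ : Z (W.ι.rightAdjoint.obj M.obj).obj := Z.prop_of_mono c M.property
    let T : CostructuredArrow (W.inverseImage Z.ι).ι M :=
      CostructuredArrow.mk (show (W.inverseImage Z.ι).ι.obj
        ⟨⟨_, hZ⟩, (W.ι.rightAdjoint.obj M.obj).property⟩ ⟶ M from Z.homMk c)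
    have key : ∀ A : CostructuredArrow (W.inverseImage Z.ι).ι M,
        ∃ k : A.left.obj.obj ⟶ (W.ι.rightAdjoint.obj M.obj).obj, k ≫ c = A.hom.hom := by
      intro A
      refine ⟨(adj.homEquiv ⟨A.left.obj.obj, A.left.property⟩ M.obj A.hom.hom).hom, ?_⟩
      have := (adj.homEquiv ⟨A.left.obj.obj, A.left.property⟩ M.obj).symm_apply_apply A.hom.hom
      rw [Adjunction.homEquiv_counit] at this
      exact this
    have ht : IsTerminal T := IsTerminal.ofUniqueHom
      (fun A => CostructuredArrow.homMk ((W.inverseImage Z.ι).homMk (Z.homMk (key A).choose)) (by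
        ext
        exact (key A).choose_spec))
      (fun A m => by
        refine CostructuredArrow.hom_ext _ _ ?_
        ext
        rw [← cancel_mono c]
        exact (congrArg (fun t => t.hom) (CostructuredArrow.w m)).trans (key A).choose_spec.symm)
    exact ht.hasTerminal

/-- The full subcategory of `C` given by a full subcategory of a subspace `Z`. -/
def pushforward (Z : ObjectProperty C) (W : ObjectProperty Z.FullSubcategory) :
    ObjectProperty C := fun X => ∃ h : Z X, W ⟨X, h⟩

instance isWeaklyClosed_pushforward (Z : ObjectProperty C) [IsClosedSubspace Z]
    (W : ObjectProperty Z.FullSubcategory) [IsWeaklyClosed W] :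
    IsWeaklyClosed (pushforward Z W) :=
  have h1 : (pushforward Z W).IsClosedUnderSubobjects := ⟨fun {X Y} f _ ⟨hY, h⟩ => by
    have hX := Z.prop_of_mono f hY
    let g : (⟨X, hX⟩ : Z.FullSubcategory) ⟶ ⟨Y, hY⟩ := Z.homMk f
    have : Mono g := Z.ι.mono_of_mono_map (by assumption)
    exact ⟨hX, W.prop_of_mono g h⟩⟩
  have h2 : (pushforward Z W).IsClosedUnderQuotients := ⟨fun {X Y} f _ ⟨hX, h⟩ => by
    have hY := Z.prop_of_epi f hX
    let g : (⟨X, hX⟩ : Z.FullSubcategory) ⟶ ⟨Y, hY⟩ := Z.homMk f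
    have : Epi g := Z.ι.epi_of_epi_map (by assumption)
    exact ⟨hY, W.prop_of_epi g h⟩⟩
  { isLeftAdjoint := by
      let D := W.FullSubcategory
      -- `L` identifies `W` with its image in `C`, so the inclusion becomes a composite of two left
      -- adjoints.
      let L : D ⥤ (pushforward Z W).FullSubcategory :=
        ObjectProperty.lift _ (W.ι ⋙ Z.ι) fun X => ⟨X.obj.property, X.property⟩
      have hL : L.IsEquivalence :=
        { faithful := ⟨fun {X Y} f g h => by
            ext
            exact congrArg (fun t => t.hom) h⟩
          full := ⟨fun {X Y} f => ⟨W.homMk (Z.homMk f.hom), rfl⟩⟩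
          essSurj := ⟨fun X => ⟨⟨⟨X.obj, X.property.choose⟩, X.property.choose_spec⟩,
            ⟨Iso.refl _⟩⟩⟩ }
      have e : L.inv ⋙ (W.ι ⋙ Z.ι) ≅ (pushforward Z W).ι :=
        L.asEquivalence.invFunIdAssoc (pushforward Z W).ι
      exact Functor.isLeftAdjoint_of_iso e }

end Support

/-! ### The map of injective spectra induced by a closed subspace -/

section InducedMap

variable {C : Type u} [Category.{v} C] [Abelian C] (Z : ObjectProperty C) [IsClosedSubspace Z]

theorem injective_supportFunctor (E : C) [Injective E] : Injective ((supportFunctor Z).obj E) :=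
  Injective.injective_of_adjoint (Adjunction.ofIsLeftAdjoint Z.ι) E

theorem essentialMono_of_map {M E : Z.FullSubcategory} {f : M ⟶ E}
    (h : EssentialMono (Z.ι.map f)) : EssentialMono f :=
  ⟨have := h.mono; Z.ι.mono_of_mono_map this, fun Y g hg => Z.ι.mono_of_mono_map
    (h.mono_of_comp _ (by rw [← Functor.map_comp]; infer_instance))⟩

variable {Z} in
/-- The injective hull in a closed subspace is the part of the ambient injective hull supported
on the subspace. -/
theorem exists_essentialMono_supportFunctor {M : Z.FullSubcategory} {E : C} {f : Z.ι.obj M ⟶ E}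
    (hf : EssentialMono f) : ∃ f' : M ⟶ (supportFunctor Z).obj E, EssentialMono f' := by
  let adj : Z.ι ⊣ supportFunctor Z := Adjunction.ofIsLeftAdjoint Z.ι
  have := mono_counit Z adj E
  have := hf.mono
  let f' := adj.homEquiv M E f
  have e : Z.ι.map f' ≫ adj.counit.app E = f := by
    have := (adj.homEquiv M E).symm_apply_apply f
    rwa [Adjunction.homEquiv_counit] at this
  have : Mono (Z.ι.map f') := mono_of_mono_fac e
  exact ⟨f', essentialMono_of_map Z (EssentialMono.of_comp_left (by rwa [e]))⟩

theorem HasInjectiveHulls.fullSubcategory (hC : HasInjectiveHulls C) :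
    HasInjectiveHulls Z.FullSubcategory := fun M => by
  obtain ⟨E, f, hE, hf⟩ := hC (Z.ι.obj M)
  obtain ⟨f', hf'⟩ := exists_essentialMono_supportFunctor hf
  exact ⟨_, f', injective_supportFunctor Z E, hf'⟩

variable {Z} in
theorem uniform_map {U : Z.FullSubcategory} (hU : Uniform U) : Uniform (Z.ι.obj U) := by
  refine ⟨fun h => hU.not_isZero ?_, fun A a _ ha => ⟨inferInstance, fun Y g hg => ?_⟩⟩
  · rw [IsZero.iff_id_eq_zero]
    ext
    exact h.eq_of_src _ _
  · have hA : Z A := Z.prop_of_mono a U.property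
    let a' : (⟨A, hA⟩ : Z.FullSubcategory) ⟶ U := Z.homMk a
    have ha' : Mono a' := Z.ι.mono_of_mono_map (by assumption)
    have h1 := hU.essential a' ha' fun h0 => ha (congrArg (fun t => t.hom) h0)
    -- The target of `g` may lie outside `Z`, but its image is a quotient of `U`.
    have hI : Z (image g) := Z.prop_of_epi (factorThruImage g) U.property
    let g' : U ⟶ (⟨image g, hI⟩ : Z.FullSubcategory) := Z.homMk (factorThruImage g)
    have h2 : Mono (a ≫ factorThruImage g) := by
      have : (a ≫ factorThruImage g) ≫ image.ι g = a ≫ g := by simp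
      exact mono_of_mono_fac this
    have h3 : Mono g' := h1.mono_of_comp g' (Z.ι.mono_of_mono_map h2)
    have h4 : Mono (factorThruImage g) := inferInstanceAs (Mono (Z.ι.map g'))
    rw [← image.fac g]
    infer_instance

theorem exists_indecInj_hull (hC : HasInjectiveHulls C) {U : C} (hU : Uniform U) :
    ∃ (F : IndecInj C) (f : U ⟶ F.obj), EssentialMono f := by
  obtain ⟨E, f, hE, hf⟩ := hC U
  exact ⟨⟨E, hE, (hU.of_essentialMono hf).indecomposable⟩, f, hf⟩

theorem IndecInj.uniform (hC : HasInjectiveHulls C) (E : IndecInj C) : Uniform E.obj :=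
  have := E.injective
  hC.uniform E.indecomposable

theorem exists_isInducedMap (hC : HasInjectiveHulls C) :
    ∃ φ : Inj Z.FullSubcategory → Inj C, IsInducedMap Z φ := by
  choose F f hf using fun E : IndecInj Z.FullSubcategory =>
    exists_indecInj_hull hC (uniform_map (E.uniform (hC.fullSubcategory Z)))
  have key (E E' : IndecInj Z.FullSubcategory) (h : E ≈ E') : (F E).toInj = (F E').toInj := by
    obtain ⟨e⟩ := h
    have := (F E).injective
    have := (F E').injective
    obtain ⟨t, -⟩ := (hf E).exists_iso ((EssentialMono.of_isIso (Z.ι.map e.hom)).comp (hf E'))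
    exact (toInj_eq_iff _ _).2 ⟨t⟩
  refine ⟨Quotient.lift (fun E => (F E).toInj) key, fun E G => ?_⟩
  have := (F E).injective
  have := G.injective
  change (F E).toInj = G.toInj ↔ _
  rw [toInj_eq_iff]
  constructor
  · rintro ⟨e⟩
    exact ⟨f E ≫ e.hom, (isInjectiveHull_iff _).2 ⟨G.injective, (hf E).comp (.of_isIso _)⟩⟩
  · rintro ⟨g, hg⟩
    obtain ⟨e, -⟩ := (hf E).exists_iso ((isInjectiveHull_iff g).1 hg).2
    exact ⟨e⟩

variable {Z} in
theorem IsInducedMap.exists_essentialMono {φ : Inj Z.FullSubcategory → Inj C}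
    (hφ : IsInducedMap Z φ) (E : IndecInj Z.FullSubcategory) : ∃ (F : IndecInj C)
      (f : Z.ι.obj E.obj ⟶ F.obj), φ E.toInj = F.toInj ∧ EssentialMono f := by
  obtain ⟨F, hF⟩ := (φ E.toInj).exists_rep
  obtain ⟨f, hf⟩ := (hφ E F).1 hF.symm
  exact ⟨F, f, hF.symm, ((isInjectiveHull_iff f).1 hf).2⟩

variable {Z} in
theorem IsInducedMap.injective {φ : Inj Z.FullSubcategory → Inj C} (hφ : IsInducedMap Z φ) :
    Function.Injective φ := by
  intro x y h
  obtain ⟨E, rfl⟩ := x.exists_rep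
  obtain ⟨E', rfl⟩ := y.exists_rep
  obtain ⟨F, f, hF, hf⟩ := hφ.exists_essentialMono E
  obtain ⟨F', f', hF', hf'⟩ := hφ.exists_essentialMono E'
  obtain ⟨e⟩ := (toInj_eq_iff F F').1 (by rw [← hF, h, hF'])
  -- `E ⟶ i^! F` is essential and both sides are injective, so it must be an isomorphism.
  have key (E : IndecInj Z.FullSubcategory) {F : IndecInj C} {f : Z.ι.obj E.obj ⟶ F.obj}
      (hf : EssentialMono f) : Nonempty (E.obj ≅ (supportFunctor Z).obj F.obj) := by
    have := F.injective
    have := E.injective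
    have := injective_supportFunctor Z F.obj
    obtain ⟨g, hg⟩ := exists_essentialMono_supportFunctor hf
    obtain ⟨t, -⟩ := (EssentialMono.of_isIso (𝟙 E.obj)).exists_iso hg
    exact ⟨t⟩
  obtain ⟨t⟩ := key E hf
  obtain ⟨t'⟩ := key E' hf'
  exact (toInj_eq_iff E E').2 ⟨t ≪≫ (supportFunctor Z).mapIso e ≪≫ t'.symm⟩

variable {Z} in
theorem IsInducedMap.range_eq (hC : HasInjectiveHulls C) {φ : Inj Z.FullSubcategory → Inj C}
    (hφ : IsInducedMap Z φ) : Set.range φ = supportSet Z := by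
  ext x
  obtain ⟨F, rfl⟩ := x.exists_rep
  rw [toInj_mem_supportSet_iff]
  constructor
  · rintro ⟨y, hy⟩
    obtain ⟨E, rfl⟩ := y.exists_rep
    obtain ⟨f, hf⟩ := (hφ E F).1 hy
    have := hf.mono
    refine ⟨_, f, E.obj.property, hf.mono, fun h0 => E.indecomposable.1 ?_⟩
    rw [IsZero.iff_id_eq_zero]
    ext
    exact zero_of_comp_mono f (by rw [h0, comp_zero])
  · intro h
    have := F.injective
    have hF := F.uniform hC
    rw [← not_isZero_supportFunctor_iff] at h
    let G := (supportFunctor Z).obj F.obj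
    let adj : Z.ι ⊣ supportFunctor Z := Adjunction.ofIsLeftAdjoint Z.ι
    let c : Z.ι.obj G ⟶ F.obj := adj.counit.app F.obj
    have hc : Mono c := mono_counit Z adj F.obj
    have hG : ¬ IsZero (Z.ι.obj G) := fun h0 => h <| by
      rw [IsZero.iff_id_eq_zero]
      ext
      exact h0.eq_of_src _ _
    have hc0 : c ≠ 0 := fun h0 => hG <| by
      rw [IsZero.iff_id_eq_zero]
      exact zero_of_comp_mono c (by rw [h0, comp_zero])
    -- The inclusion preserves biproducts, so a decomposition of `G` would decompose a nonzero
    -- subobject of the uniform `F`.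
    have hind : Indecomposable G := by
      refine ⟨h, fun X Y e => ?_⟩
      have : PreservesLimitsOfSize.{0, 0} Z.ι :=
        (Adjunction.ofIsRightAdjoint Z.ι).rightAdjoint_preservesLimits
      have : PreservesBinaryBiproduct X Y Z.ι :=
        preservesBinaryBiproduct_of_preservesBinaryProduct Z.ι
      have hXY := (hF.of_mono c hG).indecomposable.2 (Z.ι.obj X) (Z.ι.obj Y)
        (Z.ι.mapIso e ≪≫ Z.ι.mapBiprod X Y)
      refine hXY.imp (fun h0 => ?_) (fun h0 => ?_) <;>
      · rw [IsZero.iff_id_eq_zero]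
        ext
        exact h0.eq_of_src _ _
    exact ⟨IndecInj.toInj ⟨G, injective_supportFunctor Z F.obj, hind⟩, (hφ _ F).2
      ⟨c, (isInjectiveHull_iff c).2 ⟨inferInstance, hF.essential c hc hc0⟩⟩⟩

variable {Z} in
theorem IsInducedMap.preimage_supportSet {φ : Inj Z.FullSubcategory → Inj C}
    (hφ : IsInducedMap Z φ) (W : ObjectProperty C) [IsWeaklyClosed W] :
    φ ⁻¹' supportSet W = supportSet (W.inverseImage Z.ι) := by
  ext x
  obtain ⟨E, rfl⟩ := x.exists_rep
  obtain ⟨F, f, hF, hf⟩ := hφ.exists_essentialMono E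
  have := hf.mono
  rw [Set.mem_preimage, hF, toInj_mem_supportSet_iff, toInj_mem_supportSet_iff]
  constructor
  · rintro ⟨A, a, hA, _, ha⟩
    obtain ⟨T, x, y, hx, hy, e, h0⟩ := hf.exists_ne_zero a ha
    let y' : (⟨T, Z.prop_of_mono y E.obj.property⟩ : Z.FullSubcategory) ⟶ E.obj := Z.homMk y
    refine ⟨_, y', W.prop_of_mono x hA, Z.ι.mono_of_mono_map hy, fun hy0 => h0 ?_⟩
    have : y = 0 := congrArg (fun t => t.hom) hy0
    rw [e, this, zero_comp]
  · rintro ⟨A, a, hA, _, ha⟩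
    refine ⟨_, Z.ι.map a ≫ f, hA, inferInstance, fun h0 => ha ?_⟩
    ext
    exact zero_of_comp_mono f h0

variable {Z} in
theorem IsInducedMap.preimage_supportSet_pushforward {φ : Inj Z.FullSubcategory → Inj C}
    (hφ : IsInducedMap Z φ) (W : ObjectProperty Z.FullSubcategory) [IsWeaklyClosed W]
    [IsWeaklyClosed (pushforward Z W)] :
    φ ⁻¹' supportSet (pushforward Z W) = supportSet W := by
  rw [hφ.preimage_supportSet]
  ext x
  obtain ⟨E, rfl⟩ := x.exists_rep
  rw [toInj_mem_supportSet_iff, toInj_mem_supportSet_iff]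
  have (A : Z.FullSubcategory) : (pushforward Z W).inverseImage Z.ι A ↔ W A :=
    ⟨fun ⟨_, h⟩ => h, fun h => ⟨A.property, h⟩⟩
  simp only [this]

variable {Z} in
theorem IsInducedMap.isInducing {φ : Inj Z.FullSubcategory → Inj C} (hφ : IsInducedMap Z φ) :
    Topology.IsInducing φ := by
  constructor
  refine le_antisymm ?_ ?_
  · rw [← continuous_iff_le_induced]
    refine continuous_generateFrom_iff.2 ?_
    rintro _ ⟨W, hW, rfl⟩
    rw [Set.preimage_compl, hφ.preimage_supportSet]
    exact TopologicalSpace.isOpen_generateFrom_of_mem ⟨_, inferInstance, rfl⟩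
  · refine le_generateFrom ?_
    rintro _ ⟨W, hW, rfl⟩
    refine isOpen_induced_iff.2 ⟨(supportSet (pushforward Z W))ᶜ,
      TopologicalSpace.isOpen_generateFrom_of_mem ⟨_, inferInstance, rfl⟩, ?_⟩
    rw [Set.preimage_compl, hφ.preimage_supportSet_pushforward]

end InducedMap

theorem exists_isInducedMap_redSubspace (C : Type u) [Category.{v} C] [Abelian C]
    [IsGrothendieckAbelian.{v} C] (h : EnoughPrimeModules C) :
    ∃ φ : Inj (redSubspace C).FullSubcategory → Inj C,
      IsInducedMap (redSubspace C) φ ∧ IsHomeomorph φ := by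
  have hC : HasInjectiveHulls C := hasInjectiveHulls
  obtain ⟨φ, hφ⟩ := exists_isInducedMap (redSubspace C) hC
  refine ⟨φ, hφ, isHomeomorph_iff_isEmbedding_surjective.2 ⟨⟨hφ.isInducing, hφ.injective⟩, ?_⟩⟩
  rw [← Set.range_eq_univ, hφ.range_eq hC, Set.eq_univ_iff_forall]
  intro x
  obtain ⟨E, rfl⟩ := x.exists_rep
  obtain ⟨N, hN, hp⟩ := h E.obj E.indecomposable.1
  refine (toInj_mem_supportSet_iff _ _).2 ⟨N, N.arrow, fun Z _ hZ => hZ _ hp, inferInstance, ?_⟩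
  rwa [Ne, ← Subobject.mk_eq_bot_iff_zero, Subobject.mk_arrow]

/-! ### Annihilators in prime noetherian rings -/

section PrimeNoetherian

variable {S : Type w} [Ring S] [IsNoetherianRing S]

/-- A prime left noetherian ring is left nonsingular: the left annihilator of a nonzero element
is not an essential left ideal. -/
theorem IsPrimeRing.exists_disjoint_annihilator (hS : IsPrimeRing S) {z : S} (hz : z ≠ 0) :
    ∃ L : Ideal S, L ≠ ⊥ ∧ ∀ x ∈ L, x * z = 0 → x = 0 := by
  by_contra hsing
  -- Among nonzero elements with essential annihilator, choose `z` with maximal annihilator; `z * s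
  -- * z` will contradict maximality.
  let T : Set (Ideal S) := {I | ∃ z : S, z ≠ 0 ∧
    (¬ ∃ L : Ideal S, L ≠ ⊥ ∧ ∀ x ∈ L, x * z = 0 → x = 0) ∧ I = Ideal.torsionOf S S z}
  obtain ⟨I, ⟨z, hz, hsing, rfl⟩, hmax⟩ :=
    set_has_maximal_iff_noetherian.2 ‹IsNoetherianRing S› T ⟨_, z, hz, hsing, rfl⟩
  obtain ⟨s, hs⟩ : ∃ s, z * s * z ≠ 0 := by
    by_contra! h
    exact hz ((hS.2 z z h).elim id id)
  have hsz : ¬ ∃ L : Ideal S, L ≠ ⊥ ∧ ∀ x ∈ L, x * (s * z) = 0 → x = 0 := by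
    rintro ⟨L, hL, h⟩
    refine hsing ⟨Submodule.map (LinearMap.toSpanSingleton S S s) L, ?_, ?_⟩
    · obtain ⟨x, hx, hx0⟩ := (Submodule.ne_bot_iff _).1 hL
      refine (Submodule.ne_bot_iff _).2 ⟨x * s, ⟨x, hx, by simp⟩, fun h0 => hx0 (h x hx ?_)⟩
      rw [← mul_assoc, h0, zero_mul]
    · rintro _ ⟨x, hx, rfl⟩ h0
      simp only [LinearMap.toSpanSingleton_apply, smul_eq_mul] at h0 ⊢
      rw [h x hx (by rw [← mul_assoc, h0]), zero_mul]
  -- The annihilator of `s * z` is essential, so it meets `S z`.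
  obtain ⟨u, hu, hu0⟩ : ∃ u, u * z ≠ 0 ∧ u * (z * s * z) = 0 := by
    by_contra! h
    refine hsz ⟨Submodule.span S {z}, by simpa using hz, fun x hx h0 => ?_⟩
    obtain ⟨u, rfl⟩ := Submodule.mem_span_singleton.1 hx
    by_contra hne
    exact h u hne (by simpa [mul_assoc] using h0)
  have hz' (x : S) (hx : x * z = 0) : x * (z * s * z) = 0 := by
    rw [mul_assoc, ← mul_assoc x, hx, zero_mul]
  refine hmax _ ⟨z * s * z, hs, ?_, rfl⟩ (SetLike.lt_iff_le_and_exists.2 ⟨fun x hx => ?_, u, ?_⟩)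
  · rintro ⟨L, hL, h⟩
    exact hsing ⟨L, hL, fun x hx h0 => h x hx (hz' x h0)⟩
  · exact hz' x hx
  · exact ⟨hu0, hu⟩

/-- In a prime left noetherian ring, every nonzero left ideal contains a finite subset whose left
annihilator vanishes. -/
theorem IsPrimeRing.exists_finset_annihilator (hS : IsPrimeRing S) {W : Ideal S} (hW : W ≠ ⊥) :
    ∃ F : Finset S, (∀ w ∈ F, w ∈ W) ∧ ∀ s, (∀ w ∈ F, s * w = 0) → s = 0 := by
  classical
  let T : Set (Ideal S) := {D | ∃ F : Finset S, (∀ w ∈ F, w ∈ W) ∧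
    ∀ s ∈ D, (∀ w ∈ F, s * w = 0) → s = 0}
  obtain ⟨D, ⟨F, hF, hD⟩, hmax⟩ := set_has_maximal_iff_noetherian.2 ‹IsNoetherianRing S› T
    ⟨⊥, ∅, by simp, fun s hs _ => by simpa using hs⟩
  refine ⟨F, hF, fun y hy => ?_⟩
  by_contra hy0
  obtain ⟨w, hw, hw0⟩ := (Submodule.ne_bot_iff _).1 hW
  obtain ⟨r, hr⟩ : ∃ r, y * r * w ≠ 0 := by
    by_contra! h
    exact (hS.2 y w h).elim hy0 hw0
  obtain ⟨V, hV, hVr⟩ := hS.exists_disjoint_annihilator hr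
  have hVy (x : S) (hx : x ∈ V) (h0 : x * y = 0) : x = 0 :=
    hVr x hx (by rw [mul_assoc y, ← mul_assoc, h0, zero_mul])
  have hker (x : S) : ∀ t ∈ F, x * y * t = 0 := fun t ht => by rw [mul_assoc, hy t ht, mul_zero]
  -- `V y` annihilates `F`, hence is independent of `D`; the new element `r * w` of `W` detects it.
  refine hmax (D ⊔ Submodule.map (LinearMap.toSpanSingleton S S y) V) ⟨insert (r * w) F, ?_, ?_⟩ ?_
  · intro t ht
    obtain rfl | ht := Finset.mem_insert.1 ht
    · exact W.mul_mem_left r hw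
    · exact hF t ht
  · intro s hs h
    obtain ⟨d, hd, _, ⟨x, hx, rfl⟩, rfl⟩ := Submodule.mem_sup.1 hs
    simp only [LinearMap.toSpanSingleton_apply, smul_eq_mul] at h ⊢
    have hd0 : d = 0 := hD d hd fun t ht => by
      have := h t (Finset.mem_insert_of_mem ht)
      rwa [add_mul, hker x t ht, add_zero] at this
    subst hd0
    have := h _ (Finset.mem_insert_self _ _)
    rw [zero_add] at this ⊢
    rw [hVr x hx (by rw [← this]; simp only [mul_assoc]), zero_mul]
  · obtain ⟨x, hx, hx0⟩ := (Submodule.ne_bot_iff _).1 hV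
    have hxm : x * y ∈ Submodule.map (LinearMap.toSpanSingleton S S y) V := ⟨x, hx, by simp⟩
    refine SetLike.lt_iff_le_and_exists.2 ⟨le_sup_left, x * y, le_sup_right (a := D) hxm, ?_⟩
    exact fun hmem => hx0 (hVy x hx (hD _ hmem (hker x)))

end PrimeNoetherian

/-! ### Uniform submodules of noetherian modules -/

section Modules

variable {A : Type w} [Ring A]

/-- Take `K` maximal among submodules disjoint from some nonzero `U`. Disjoint nonzero `P`, `Q`
inside `U` would make `K ⊔ P` a larger one, disjoint from `Q`. -/
theorem exists_uniform_submodule {M : Type w} [AddCommGroup M] [Module A M] [IsNoetherian A M]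
    [Nontrivial M] : ∃ U : Submodule A M, U ≠ ⊥ ∧
      ∀ P Q : Submodule A M, P ≤ U → Q ≤ U → Disjoint P Q → P = ⊥ ∨ Q = ⊥ := by
  obtain ⟨K, ⟨U, hU, hKU⟩, hmax⟩ := set_has_maximal_iff_noetherian.2 ‹IsNoetherian A M›
    {K | ∃ U : Submodule A M, U ≠ ⊥ ∧ Disjoint K U} ⟨⊥, ⊤, top_ne_bot, disjoint_bot_left⟩
  refine ⟨U, hU, fun P Q hP hQ hPQ => ?_⟩
  by_contra! h
  have hd : Disjoint (K ⊔ P) Q := hPQ.disjoint_sup_left_of_disjoint_sup_right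
    (hKU.mono_right (sup_le hP hQ))
  refine hmax (K ⊔ P) ⟨Q, h.2, hd⟩ (lt_of_le_of_ne le_sup_left fun e => h.1 ?_)
  exact disjoint_self.1 (hKU.mono (sup_eq_left.1 e.symm) hP)

theorem uniform_of_submodule {M : Type w} [AddCommGroup M] [Module A M] {U : Submodule A M}
    (hU : U ≠ ⊥) (h : ∀ P Q : Submodule A M, P ≤ U → Q ≤ U → Disjoint P Q → P = ⊥ ∨ Q = ⊥) :
    Uniform (ModuleCat.of A U) := by
  refine ⟨fun h0 => hU ?_, fun B a ha ha0 => ⟨ha, fun Y g hg => ?_⟩⟩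
  · have := ModuleCat.subsingleton_of_isZero h0
    exact (Submodule.subsingleton_iff_eq_bot).1 this
  · rw [ModuleCat.mono_iff_ker_eq_bot] at hg ⊢
    have hd : Disjoint (LinearMap.range a.hom) (LinearMap.ker g.hom) := by
      rw [Submodule.disjoint_def]
      rintro _ ⟨x, rfl⟩ hx
      have : x ∈ LinearMap.ker (a ≫ g).hom := hx
      rw [hg, Submodule.mem_bot] at this
      rw [this, map_zero]
    have hinj := Submodule.map_injective_of_injective U.injective_subtype
    have hbot (P : Submodule A U) (hP : P.map U.subtype = ⊥) : P = ⊥ :=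
      hinj (hP.trans (Submodule.map_bot _).symm)
    refine ((h _ _ (Submodule.map_subtype_le _ _) (Submodule.map_subtype_le _ _)
      (Submodule.disjoint_map U.injective_subtype hd)).imp (hbot _) (hbot _)).resolve_left ?_
    intro h0
    refine ha0 (ModuleCat.hom_ext ?_)
    exact LinearMap.range_eq_bot.1 h0

/-- A nonzero noetherian module `M` has an indecomposable injective all of whose supports are
detected on `M`: the injective hull of a uniform submodule. -/
theorem exists_indecInj_of_isNoetherian (M : Type w) [AddCommGroup M] [Module A M]
    [IsNoetherian A M] [Nontrivial M] : ∃ F : IndecInj (ModuleCat.{w} A),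
      ∀ (Z : ObjectProperty (ModuleCat.{w} A)) [IsWeaklyClosed Z], F.toInj ∈ supportSet Z →
        ∃ N : Submodule A M, N ≠ ⊥ ∧ Z (ModuleCat.of A N) := by
  obtain ⟨U, hU, h⟩ := exists_uniform_submodule (A := A) (M := M)
  obtain ⟨F, f, hf⟩ := exists_indecInj_hull hasInjectiveHulls (uniform_of_submodule hU h)
  refine ⟨F, fun Z _ hF => ?_⟩
  obtain ⟨B, a, hB, _, ha⟩ := (toInj_mem_supportSet_iff Z F).1 hF
  obtain ⟨T, x, y, hx, hy, e, h0⟩ := hf.exists_ne_zero a ha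
  let t : T →ₗ[A] M := U.subtype ∘ₗ y.hom
  have ht : Function.Injective t :=
    U.injective_subtype.comp ((ModuleCat.mono_iff_injective y).1 hy)
  refine ⟨LinearMap.range t, fun hb => h0 ?_, ?_⟩
  · have hy0 : y = 0 := by
      ext v
      have : t v = 0 := by rw [LinearMap.range_eq_bot.1 hb]; rfl
      exact this
    rw [e, hy0, zero_comp]
  · exact Z.prop_of_iso (LinearEquiv.ofInjective t ht).toModuleIso (Z.prop_of_mono x hB)

theorem toInj_mem_supportSet_of_ne_zero {C : Type u} [Category.{v} C] [Abelian C]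
    (Z : ObjectProperty C) [IsWeaklyClosed Z] (E : IndecInj C) {B : C} (b : B ⟶ E.obj) (hB : Z B)
    (hb : b ≠ 0) : E.toInj ∈ supportSet Z :=
  (toInj_mem_supportSet_iff Z E).2 ⟨image b, image.ι b, Z.prop_of_epi (factorThruImage b) hB,
    inferInstance, fun h => hb (by rw [← image.fac b, h, comp_zero])⟩

end Modules

/-! ### The generic point attached to a prime quotient ring -/

section PrimeQuotient

variable {A S : Type w} [Ring A] [Ring S]

/-- A weakly closed subspace of `Mod A` containing a nonzero left ideal of a prime left noetherian
`A`-ring `S` contains `S`. -/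
theorem prop_of_isPrimeRing [Module A S] [IsScalarTower A S S] [IsNoetherianRing S]
    (hS : IsPrimeRing S) (Z : ObjectProperty (ModuleCat.{w} A)) [IsWeaklyClosed Z]
    (N : Submodule A S) (hN : N ≠ ⊥) (hmul : ∀ s : S, ∀ n ∈ N, s * n ∈ N)
    (hZ : Z (ModuleCat.of A N)) : Z (ModuleCat.of A S) := by
  let W : Ideal S := { N.toAddSubmonoid with smul_mem' := fun s n hn => hmul s n hn }
  have hW : W ≠ ⊥ := by
    obtain ⟨x, hx, hx0⟩ := (Submodule.ne_bot_iff _).1 hN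
    exact (Submodule.ne_bot_iff _).2 ⟨x, hx, hx0⟩
  obtain ⟨F, hF, hF0⟩ := hS.exists_finset_annihilator hW
  -- Right multiplications by the elements of `F` jointly embed `S` in a finite power of `N`.
  let g (x : F) : ModuleCat.of A S ⟶ ModuleCat.of A N := ModuleCat.ofHom
    { toFun s := ⟨s * x, hmul s x (hF x x.2)⟩
      map_add' s t := Subtype.ext (add_mul s t x)
      map_smul' a s := Subtype.ext (smul_mul_assoc a s (x : S)) }
  have hZ' : Z (⨁ fun _ : F => ModuleCat.of A N) :=
    Z.prop_of_iso (biproduct.isoCoproduct _).symm (IsWeaklyClosed.prop_sigma Z _ fun _ => hZ)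
  have : Mono (biproduct.lift g) := Preadditive.mono_of_cancel_zero _ fun {T} h hh => by
    ext t
    refine hF0 _ fun x hx => ?_
    have h1 : h ≫ g ⟨x, hx⟩ = 0 := by
      rw [← biproduct.lift_π g ⟨x, hx⟩, reassoc_of% hh, zero_comp]
    exact congrArg Subtype.val (congrArg (fun k => k.hom t) h1)
  exact Z.prop_of_mono (biproduct.lift g) hZ'

/-- The generic point of `Mod S`, for `S` a prime left noetherian quotient ring of `A`. -/
theorem exists_generic_indecInj [IsNoetherianRing A] (f : A →+* S) (hf : Function.Surjective f)
    (hS : IsPrimeRing S) : ∃ F : IndecInj (ModuleCat.{w} A),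
      ∀ (Z : ObjectProperty (ModuleCat.{w} A)) [IsWeaklyClosed Z], F.toInj ∈ supportSet Z →
        ∀ (E : IndecInj (ModuleCat.{w} A)) (n : E.obj), n ≠ 0 → (∀ a, f a = 0 → a • n = 0) →
          E.toInj ∈ supportSet Z := by
  let _ : Module A S := Module.compHom S f
  have hsmul (a : A) (s : S) : a • s = f a * s := rfl
  have : IsScalarTower A S S := ⟨fun a s t => by
    rw [smul_eq_mul, smul_eq_mul, hsmul, hsmul, mul_assoc]⟩
  have := isNoetherianRing_of_surjective A S f hf
  have := hS.1
  let l : A →ₗ[A] S := { f with map_smul' := fun a b => by simp [hsmul] }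
  have hl : Function.Surjective l := hf
  have : IsNoetherian A S := isNoetherian_of_surjective l (LinearMap.range_eq_top.2 hl)
  obtain ⟨F, hF⟩ := exists_indecInj_of_isNoetherian (A := A) S
  refine ⟨F, fun Z _ hZ E n hn h => ?_⟩
  obtain ⟨N, hN, hZN⟩ := hF Z hZ
  have hZS := prop_of_isPrimeRing hS Z N hN (fun s n hn => by
    obtain ⟨a, rfl⟩ := hf s
    exact N.smul_mem a hn) hZN
  -- Since `ker f` kills `n`, the map `a ↦ a • n` descends to `S`, and it is nonzero at `1`.
  let q : (A ⧸ LinearMap.ker l) →ₗ[A] E.obj :=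
    (LinearMap.ker l).liftQ (LinearMap.toSpanSingleton A E.obj n) fun a ha => h a ha
  let b : ModuleCat.of A S ⟶ E.obj :=
    ModuleCat.ofHom (q ∘ₗ (l.quotKerEquivOfSurjective hl).symm.toLinearMap)
  refine toInj_mem_supportSet_of_ne_zero Z E b hZS fun h0 => hn ?_
  have h1 : b.hom (l 1) = 0 := by rw [h0]; rfl
  have h2 : (l.quotKerEquivOfSurjective hl).symm (l 1) = Submodule.Quotient.mk 1 := by
    rw [LinearEquiv.symm_apply_eq]; rfl
  have h3 : b.hom (l 1) = q ((l.quotKerEquivOfSurjective hl).symm (l 1)) := rfl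
  rw [h3, h2] at h1
  have h4 : q (Submodule.Quotient.mk 1) = (1 : A) • n := rfl
  rwa [h4, one_smul] at h1

end PrimeQuotient

/-! ### Right modules, prime ideals and irreducibility -/

section RightNoetherian

open MulOpposite

variable {R : Type w} [Ring R]

/-- A maximal annihilator of a nonzero submodule is prime: if `a R b` kills `N` but `a` does not,
`b` kills the nonzero submodule generated by some `n a`, whose annihilator is no larger. -/
theorem exists_isPrimeIdeal_annihilator [IsNoetherianRing Rᵐᵒᵖ] (M : Type w) [AddCommGroup M]
    [Module Rᵐᵒᵖ M] [Nontrivial M] : ∃ (N : Submodule Rᵐᵒᵖ M) (P : TwoSidedIdeal R), N ≠ ⊥ ∧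
      IsPrimeIdeal P ∧ ∀ p ∈ P, ∀ n ∈ N, op p • n = 0 := by
  obtain ⟨_, ⟨N, hN, rfl⟩, hmax⟩ :=
    set_has_maximal_iff_noetherian.2 ‹IsNoetherianRing Rᵐᵒᵖ›
      {I : Ideal Rᵐᵒᵖ | ∃ N : Submodule Rᵐᵒᵖ M, N ≠ ⊥ ∧ I = N.annihilator}
      ⟨_, ⊤, top_ne_bot, rfl⟩
  let P : TwoSidedIdeal R := TwoSidedIdeal.mk' {p | ∀ n ∈ N, op p • n = 0}
    (fun n _ => by simp) (fun hx hy n hn => by rw [MulOpposite.op_add, add_smul, hx n hn, hy n hn, add_zero])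
    (fun hx n hn => by rw [MulOpposite.op_neg, neg_smul, hx n hn, neg_zero])
    (fun {x y} hy n hn => by rw [op_mul, mul_smul]; exact hy _ (N.smul_mem _ hn))
    (fun {x y} hx n hn => by rw [op_mul, mul_smul, hx n hn, smul_zero])
  have hP (p : R) : p ∈ P ↔ ∀ n ∈ N, op p • n = 0 := TwoSidedIdeal.mem_mk' _ _ _ _ _ _ p
  refine ⟨N, P, hN, ⟨fun h => hN ?_, fun a b hab => ?_⟩, fun p hp => (hP p).1 hp⟩
  · rw [Submodule.eq_bot_iff]
    intro n hn
    have := (hP 1).1 (h ▸ TwoSidedIdeal.mem_top R) n hn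
    simpa using this
  · by_contra! h
    obtain ⟨n, hn, hn0⟩ : ∃ n ∈ N, op a • n ≠ 0 := by
      have := mt (hP a).2 h.1
      push Not at this
      exact this
    let N' : Submodule Rᵐᵒᵖ M := Submodule.span Rᵐᵒᵖ {op a • n}
    have hN' : N' ≤ N := by
      rw [Submodule.span_singleton_le_iff_mem]
      exact N.smul_mem _ hn
    have hle := Submodule.annihilator_mono hN'
    refine hmax _ ⟨N', by simpa [N'] using hn0, rfl⟩
      (SetLike.lt_iff_le_and_exists.2 ⟨hle, op b, ?_, fun hb => h.2 ((hP b).2 ?_)⟩)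
    · rw [Submodule.mem_annihilator]
      intro m hm
      obtain ⟨r, rfl⟩ := Submodule.mem_span_singleton.1 hm
      have := (hP _).1 (hab r.unop) n hn
      simpa [mul_smul] using this
    · exact Submodule.mem_annihilator.1 hb

/-- The modules annihilated by the element `a`. -/
def annihilatedBy (a : R) : ObjectProperty (ModuleCat.{w} Rᵐᵒᵖ) := fun M => ∀ m : M, op a • m = 0

instance isWeaklyClosed_annihilatedBy (a : R) : IsWeaklyClosed (annihilatedBy a) :=
  have h1 : (annihilatedBy a).IsClosedUnderSubobjects := ⟨fun f hf hY m =>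
    (ModuleCat.mono_iff_injective f).1 hf (by
      have := hY (f.hom m)
      rw [← map_smul] at this
      exact this.trans (map_zero f.hom).symm)⟩
  have h2 : (annihilatedBy a).IsClosedUnderQuotients := ⟨fun f hf hX m => by
    obtain ⟨n, rfl⟩ := (ModuleCat.epi_iff_surjective f).1 hf m
    have := congrArg f.hom (hX n)
    rw [map_smul, map_zero] at this
    exact this⟩
  { isLeftAdjoint := isLeftAdjoint_of_prop_sigma _ fun J X hX m => by
      -- The action of `a` need not be linear; quantifying over `r` makes its vanishing locus a
      -- submodule, which contains every summand.
      let K : Submodule Rᵐᵒᵖ (∐ X : ModuleCat Rᵐᵒᵖ) :=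
        { carrier := {m | ∀ r : Rᵐᵒᵖ, op a • r • m = 0}
          zero_mem' := fun r => by simp
          add_mem' := fun hx hy r => by rw [smul_add, smul_add, hx r, hy r, add_zero]
          smul_mem' := fun c x hx r => by rw [smul_smul r c x]; exact hx _ }
      have h0 : ModuleCat.ofHom K.mkQ = 0 := by
        refine Sigma.hom_ext _ _ fun j => ?_
        ext x
        refine (Submodule.Quotient.mk_eq_zero K).2 fun r => ?_
        rw [← map_smul, ← map_smul, hX j, map_zero]
      have hm : m ∈ K := (Submodule.Quotient.mk_eq_zero K).1 (congrArg (fun t => t.hom m) h0)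
      simpa using hm 1 }

theorem mem_primeRadical_iff (a : R) : a ∈ primeRadical R ↔ ∀ P, IsPrimeIdeal P → a ∈ P :=
  TwoSidedIdeal.mem_sInf R

/-- An element killing part of every indecomposable injective lies in every prime ideal. -/
theorem mem_primeRadical_of_supportSet_eq_univ [IsNoetherianRing Rᵐᵒᵖ] (a : R)
    (h : supportSet (annihilatedBy a) = Set.univ) : a ∈ primeRadical R := by
  refine (mem_primeRadical_iff a).2 fun P hP => ?_
  let K : Submodule Rᵐᵒᵖ Rᵐᵒᵖ :=
    { carrier := {x | x.unop ∈ P}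
      zero_mem' := P.zero_mem
      add_mem' := P.add_mem
      smul_mem' := fun c x hx => P.mul_mem_right x.unop c.unop hx }
  have : Nontrivial (Rᵐᵒᵖ ⧸ K) := Submodule.Quotient.nontrivial_iff.2 fun hK => hP.1 <| by
    refine (TwoSidedIdeal.one_mem_iff P).1 ?_
    have : (1 : Rᵐᵒᵖ) ∈ K := hK ▸ Submodule.mem_top
    exact this
  obtain ⟨F, hF⟩ := exists_indecInj_of_isNoetherian (A := Rᵐᵒᵖ) (Rᵐᵒᵖ ⧸ K)
  obtain ⟨N, hN, hZ⟩ := hF (annihilatedBy a) (h ▸ Set.mem_univ _)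
  obtain ⟨n, hn, hn0⟩ := (Submodule.ne_bot_iff _).1 hN
  obtain ⟨x, rfl⟩ := Submodule.Quotient.mk_surjective K n
  -- A nonzero class of `x` in a submodule of `R/P` killed by `a` means `x R a ⊆ P` with `x ∉ P`.
  refine (hP.2 x.unop a fun r => ?_).resolve_left fun hx =>
    hn0 ((Submodule.Quotient.mk_eq_zero K).2 hx)
  have h1 := congrArg Subtype.val (hZ ⟨_, N.smul_mem (op r) hn⟩)
  have h2 : Submodule.Quotient.mk (p := K) (op a * (op r * x)) = 0 := h1
  have h3 : op a * (op r * x) ∈ K := (Submodule.Quotient.mk_eq_zero K).1 h2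
  exact h3

theorem isClosed_supportSet {C : Type u} [Category.{v} C] [Abelian C] (Z : ObjectProperty C)
    [IsWeaklyClosed Z] : IsClosed (supportSet Z) :=
  ⟨TopologicalSpace.isOpen_generateFrom_of_mem ⟨Z, inferInstance, rfl⟩⟩

/-- Such an `x` is a generic point: density of `x` need only be checked on the subbasis, and the
closure of a point is irreducible. -/
theorem irreducibleSpace_of_generic {C : Type u} [Category.{v} C] [Abelian C] (x : Inj C)
    (h : ∀ (Z : ObjectProperty C) [IsWeaklyClosed Z], x ∈ supportSet Z →
      supportSet Z = Set.univ) : IrreducibleSpace (Inj C) := by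
  have hx : closure {x} = Set.univ := by
    refine Set.eq_univ_of_forall fun y => mem_closure_iff.2 fun o ho hy => ⟨x, ?_, rfl⟩
    induction ho with
    | basic s hs =>
      obtain ⟨Z, hZ, rfl⟩ := hs
      intro hxZ
      exact hy (h Z hxZ ▸ Set.mem_univ y)
    | univ => trivial
    | inter s t _ _ hs ht => exact ⟨hs hy.1, ht hy.2⟩
    | sUnion T _ hT =>
      obtain ⟨s, hs, hy⟩ := hy
      exact ⟨s, hs, hT s hs hy⟩
  have hirr : IsIrreducible (Set.univ : Set (Inj C)) := hx ▸ isIrreducible_singleton.closure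
  have : PreirreducibleSpace (Inj C) := ⟨hirr.2⟩
  exact { toNonempty := ⟨x⟩ }

theorem topologicallyIrreducible_iff_isPrimeRing [IsNoetherianRing Rᵐᵒᵖ] :
    TopologicallyIrreducible (ModuleCat.{w} Rᵐᵒᵖ) ↔
      IsPrimeRing (primeRadical R).ringCon.Quotient := by
  let π := (primeRadical R).ringCon.mk'
  have hπ : Function.Surjective π := RingCon.mk'_surjective _
  have hπ0 (a : R) : π a = 0 ↔ a ∈ primeRadical R := RingCon.eq _
  have hann (E : IndecInj (ModuleCat.{w} Rᵐᵒᵖ)) : ∃ (n : E.obj) (P : TwoSidedIdeal R), n ≠ 0 ∧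
      IsPrimeIdeal P ∧ ∀ p ∈ P, ∀ r : Rᵐᵒᵖ, op p • r • n = 0 := by
    have : Nontrivial E.obj := by
      rw [← not_subsingleton_iff_nontrivial]
      exact fun h => E.indecomposable.1 (ModuleCat.isZero_of_subsingleton _)
    obtain ⟨N, P, hN, hP, h⟩ := exists_isPrimeIdeal_annihilator (R := R) E.obj
    obtain ⟨n, hn, hn0⟩ := (Submodule.ne_bot_iff _).1 hN
    exact ⟨n, P, hn0, hP, fun p hp r => h p hp _ (N.smul_mem r hn)⟩
  constructor
  · intro h
    have h : IrreducibleSpace (Inj (ModuleCat.{w} Rᵐᵒᵖ)) := h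
    constructor
    · obtain ⟨E, -⟩ := (Classical.arbitrary (Inj (ModuleCat.{w} Rᵐᵒᵖ))).exists_rep
      obtain ⟨n, P, -, hP, -⟩ := hann E
      refine ⟨π 1, 0, fun h1 => hP.1 ?_⟩
      exact (TwoSidedIdeal.one_mem_iff P).1 ((mem_primeRadical_iff 1).1 ((hπ0 1).1 h1) P hP)
    · intro a b hab
      obtain ⟨a, rfl⟩ := hπ a
      obtain ⟨b, rfl⟩ := hπ b
      rw [hπ0, hπ0]
      have hcover : (Set.univ : Set (Inj (ModuleCat.{w} Rᵐᵒᵖ))) ⊆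
          supportSet (annihilatedBy a) ∪ supportSet (annihilatedBy b) := by
        intro x _
        obtain ⟨E, rfl⟩ := x.exists_rep
        obtain ⟨n, P, hn, hP, h⟩ := hann E
        have key (c : R) (hc : c ∈ P) : E.toInj ∈ supportSet (annihilatedBy c) := by
          let N := Submodule.span Rᵐᵒᵖ {n}
          let i : ModuleCat.of Rᵐᵒᵖ N ⟶ E.obj := ModuleCat.ofHom N.subtype
          refine toInj_mem_supportSet_of_ne_zero _ E i ?_ fun h0 => hn ?_
          · rintro ⟨m, hm⟩
            obtain ⟨r, rfl⟩ := Submodule.mem_span_singleton.1 hm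
            exact Subtype.ext (h c hc r)
          · exact congrArg (fun t => t.hom ⟨n, Submodule.mem_span_singleton_self n⟩) h0
        refine (hP.2 a b fun r => ?_).imp (key a) (key b)
        refine (mem_primeRadical_iff _).1 ((hπ0 _).1 ?_) P hP
        rw [map_mul, map_mul, hab]
      refine (isPreirreducible_iff_isClosed_union_isClosed.1
        h.toPreirreducibleSpace.isPreirreducible_univ _ _ (isClosed_supportSet _)
        (isClosed_supportSet _) hcover).imp ?_ ?_ <;>
      · intro hs
        exact mem_primeRadical_of_supportSet_eq_univ _ (Set.univ_subset_iff.1 hs)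
  · intro h
    -- Primeness is left-right symmetric, so the left-module results apply over the opposite ring.
    have hop : IsPrimeRing (primeRadical R).ringCon.Quotientᵐᵒᵖ := by
      have := h.1
      refine ⟨inferInstance, fun a b hab => ?_⟩
      refine (h.2 b.unop a.unop fun r => ?_).symm.imp (fun h => unop_injective h)
        fun h => unop_injective h
      have := congrArg unop (hab (op r))
      simpa [mul_assoc] using this
    obtain ⟨F, hF⟩ := exists_generic_indecInj (RingHom.op π)
      (fun s => (hπ s.unop).imp' op fun r hr => congrArg op hr) hop
    refine irreducibleSpace_of_generic F.toInj fun Z _ hZ => Set.eq_univ_of_forall fun x => ?_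
    obtain ⟨E, rfl⟩ := x.exists_rep
    obtain ⟨n, P, hn, hP, h⟩ := hann E
    refine hF Z hZ E n hn fun r hr => ?_
    have hr' : r.unop ∈ P := (mem_primeRadical_iff _).1 ((hπ0 _).1 (congrArg unop hr)) P hP
    simpa using h _ hr' 1

end RightNoetherian

end NCSpace

theorem mainTheorem7 :
    (∀ (C : Type u) [Category.{v} C] [Abelian C] [IsGrothendieckAbelian.{v} C],
      NCSpace.LocallyNoetherian C → NCSpace.EnoughPrimeModules C →
      ∃ φ : NCSpace.Inj (NCSpace.redSubspace C).FullSubcategory → NCSpace.Inj C,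
        NCSpace.IsInducedMap (NCSpace.redSubspace C) φ ∧ IsHomeomorph φ) ∧
    (∀ (R : Type w) [Ring R] [IsNoetherianRing Rᵐᵒᵖ],
      NCSpace.TopologicallyIrreducible (ModuleCat.{w} Rᵐᵒᵖ) ↔
        NCSpace.IsPrimeRing (NCSpace.primeRadical R).ringCon.Quotient) :=
  ⟨fun C _ _ _ _ h => NCSpace.exists_isInducedMap_redSubspace C h,
    fun _ _ _ => NCSpace.topologicallyIrreducible_iff_isPrimeRing⟩
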